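/- Let $n,m\in\mathbb N$, let $f_0\colon\mathbb R^n\to\mathbb R$ and $F\colon\mathbb R^n\to\mathbb R^m$ be twice continuously differentiable, let $g\colon\mathbb R^m\to\overline{\mathbb R}$ be proper, lower semicontinuous and convex, and put $f(x,u):=f_0(x)+g(F(x)+u)$. For $h\colon\mathbb R^d\to\overline{\mathbb R}$ and $x$ with $h(x)$ finite, let $\partial h(x)=\{z\mid (z,-1)\in N_{\operatorname{epi}h}(x,h(x))\}$ and $\partial^\infty h(x)=\{z\mid (z,0)\in N_{\operatorname{epi}h}(x,h(x))\}$ denote the limiting and the singular subdifferential, where $N$ is the limiting normal cone (both sets are empty where $h$ is not finite). Define the set-valued mappings $$M(v,u):=\{x\mid v\in\partial_x f(x,u)\},\qquad M_2(v,u):=\{(x,w)\mid v\in\nabla f_0(x)+F'(x)^\top\partial g(w),\ u=w-F(x)\}$$ for $(v,u)\in\mathbb R^n\times\mathbb R^m$, where $\partial_xf(x,u)$ is the limiting subdifferential of $f(\cdot,u)$ at $x$. Let $\bar x$ satisfy $0\in\partial_xf(\bar x,0)$, and assume the qualification condition $$F'(\bar x)^\top y=0,\ y\in\partial^\infty g(F(\bar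 x))\quad\Longrightarrow\quad y=0.$$ Then there is a neighborhood $N$ of $((0,0),\bar x)$ such that for every $((v,u),x)\in N\cap\operatorname{gph}M$ the point $((v,u),(x,F(x)+u))$ belongs to $\operatorname{gph}M_2$, and each of the following properties holds for $M$ at $((v,u),x)$ if and only if it holds for $M_2$ at $((v,u),(x,F(x)+u))$: 1. isolated calmness at the point; 2. isolated calmness around the point; 3. the Aubin property at the point; 4. existence of a single-valued Lipschitz continuous localization around the point. Here, for a set-valued mapping $\Upsilon$ and $(a,b)\in\operatorname{gph}\Upsilon$: $\Upsilon$ is isolatedly calm at $(a,b)$ with constant $\kappa>0$ if there is a neighborhood $V$ of $b$ with $\|y-b\|\le\kappa\|x-a\|$ for all $x$ and all $y\in\Upsilon(x)\cap V$, and it is isolatedly calm at $(a,b)$ if this holds for some $\kappa>0$; $\Upsilon$ is isolatedly calm around $(a,b)$ if there are $\kappa>0$ and a neighborhood $W$ of $(a,b)$ such that $\Upsilon$ is isolatedly calm with constant $\kappa$ at all points of $W\cap\operatorname{gph}\Upsilon$; $\Upsilon$ has the Aubin property at $(a,b)$ if $\operatorname{gph}\Upsilon$ is locally closed at $(a,b)$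 and there are $\kappa>0$ and neighborhoods $U$ of $a$ and $V$ of $b$ such that for all $x,x'\in U$ and $y'\in\Upsilon(x')\cap V$ there is $y\in\Upsilon(x)$ with $\|y'-y\|\le\kappa\|x'-x\|$; $\Upsilon$ has a single-valued Lipschitz continuous localization around $(a,b)$ if there are neighborhoods $U$ of $a$ and $V$ of $b$ and a locally Lipschitz continuous $\upsilon\colon U\to\mathbb R^q$ (where $\mathbb R^q$ is the image space of $\Upsilon$) with $\upsilon(a)=b$ and $(U\times V)\cap\operatorname{gph}\Upsilon=\{(x,\upsilon(x))\mid x\in U\}$. -/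

import Mathlib

open Filter Topology

noncomputable section

namespace CompositeStability

/-! ### Normal cones and subdifferentials -/

section Normals

variable {H : Type*} [NormedAddCommGroup H] [InnerProductSpace ℝ H]

/-- The regular normal cone: all `η` with `⟪η, x - a⟫ ≤ o(‖x - a‖)` for `x ∈ C`. -/
def regularNormalCone (C : Set H) (a : H) : Set H :=
  {η | ∀ ε : ℝ, 0 < ε → ∀ᶠ x in 𝓝[C] a, inner ℝ η (x - a) ≤ ε * ‖x - a‖}

/-- The limiting normal cone: limits of regular normals at nearby points of `C`. -/
def limitingNormalCone (C : Set H) (a : H) : Set H :=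
  {η | ∃ (x : ℕ → H) (ξ : ℕ → H), Tendsto x atTop (𝓝 a) ∧ Tendsto ξ atTop (𝓝 η) ∧
    ∀ k, x k ∈ C ∧ ξ k ∈ regularNormalCone C (x k)}

/-- The epigraph of an extended real-valued function, as a subset of the product `H × ℝ`
equipped with its Hilbert space structure. -/
def epigraph (h : H → EReal) : Set (WithLp 2 (H × ℝ)) :=
  {p | h p.fst ≤ (p.snd : EReal)}

/-- The limiting subdifferential (empty at points where `h` is not finite). -/
def limitingSubdifferential (h : H → EReal) (a : H) : Set H :=
  {z | h a ≠ ⊤ ∧ h a ≠ ⊥ ∧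
    WithLp.toLp 2 (z, (-1 : ℝ)) ∈
      limitingNormalCone (epigraph h) (WithLp.toLp 2 (a, (h a).toReal))}

/-- The singular subdifferential (empty at points where `h` is not finite). -/
def singularSubdifferential (h : H → EReal) (a : H) : Set H :=
  {z | h a ≠ ⊤ ∧ h a ≠ ⊥ ∧
    WithLp.toLp 2 (z, (0 : ℝ)) ∈
      limitingNormalCone (epigraph h) (WithLp.toLp 2 (a, (h a).toReal))}

/-- A proper extended real-valued function. -/
def IsProper (h : H → EReal) : Prop :=
  (∃ x, h x ≠ ⊤) ∧ ∀ x, h x ≠ ⊥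

/-- Convexity of an extended real-valued function, as convexity of its epigraph. -/
def IsConvexFun (h : H → EReal) : Prop :=
  Convex ℝ (epigraph h)

end Normals

/-! ### Lipschitzian properties of set-valued mappings -/

section SetValued

variable {P Q : Type*} [NormedAddCommGroup P] [NormedAddCommGroup Q]

/-- The graph of a set-valued mapping. -/
def gph (S : P → Set Q) : Set (P × Q) :=
  {p | p.2 ∈ S p.1}

/-- `S` is isolatedly calm at `(a, b) ∈ gph S` with constant `κ`. -/
def IsolatedlyCalmAtWith (κ : ℝ) (S : P → Set Q) (a : P) (b : Q) : Prop :=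
  (a, b) ∈ gph S ∧ ∃ V ∈ 𝓝 b, ∀ x, ∀ y ∈ S x ∩ V, ‖y - b‖ ≤ κ * ‖x - a‖

/-- `S` is isolatedly calm at `(a, b) ∈ gph S`. -/
def IsolatedlyCalmAt (S : P → Set Q) (a : P) (b : Q) : Prop :=
  ∃ κ : ℝ, 0 < κ ∧ IsolatedlyCalmAtWith κ S a b

/-- `S` is isolatedly calm around (on a neighborhood of) `(a, b) ∈ gph S`: it is isolatedly calm
at all nearby points of its graph with one common constant. -/
def IsolatedlyCalmAround (S : P → Set Q) (a : P) (b : Q) : Prop :=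
  (a, b) ∈ gph S ∧ ∃ κ : ℝ, 0 < κ ∧ ∃ W ∈ 𝓝 (a, b), ∀ p ∈ W ∩ gph S,
    IsolatedlyCalmAtWith κ S p.1 p.2

/-- `S` has the Aubin property at `(a, b) ∈ gph S`; as usual in finite dimensions, local
closedness of the graph is part of the property. -/
def AubinPropertyAt (S : P → Set Q) (a : P) (b : Q) : Prop :=
  (a, b) ∈ gph S ∧
  (∃ W ∈ 𝓝 (a, b), IsClosed W ∧ IsClosed (W ∩ gph S)) ∧
  ∃ κ : ℝ, 0 < κ ∧ ∃ U ∈ 𝓝 a, ∃ V ∈ 𝓝 b, ∀ x ∈ U, ∀ x' ∈ U, ∀ y' ∈ S x' ∩ V,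
    ∃ y ∈ S x, ‖y' - y‖ ≤ κ * ‖x' - x‖

/-- `S` has a single-valued (locally) Lipschitz continuous localization around `(a, b)`. -/
def HasLipschitzLocalization (S : P → Set Q) (a : P) (b : Q) : Prop :=
  ∃ U ∈ 𝓝 a, ∃ V ∈ 𝓝 b, ∃ σ : P → Q, LocallyLipschitzOn U σ ∧ σ a = b ∧
    (U ×ˢ V) ∩ gph S = {p | p.1 ∈ U ∧ p.2 = σ p.1}

end SetValued

/-! ### The composite model and its perturbation mappings -/

section Model

variable {X Z : Type*} [NormedAddCommGroup X] [InnerProductSpace ℝ X] [CompleteSpace X]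
  [NormedAddCommGroup Z] [InnerProductSpace ℝ Z] [CompleteSpace Z]

/-- The composite function `f(x,u) = f₀(x) + g(F(x) + u)`. -/
def compositeFun (f₀ : X → ℝ) (F : X → Z) (g : Z → EReal) (x : X) (u : Z) : EReal :=
  (f₀ x : EReal) + g (F x + u)

/-- The mapping `M(v,u) = {x | v ∈ ∂ₓ f(x,u)}`, where `∂ₓ f(x,u)` is the limiting
subdifferential of `f(·,u)` at `x`. -/
def mapM (f : X → Z → EReal) (p : X × Z) : Set X :=
  {x | p.1 ∈ limitingSubdifferential (fun x' => f x' p.2) x}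

/-- The decoupled mapping
`M₂(v,u) = {(x,w) | v ∈ ∇f₀(x) + F'(x)ᵀ ∂g(w), u = w - F(x)}`. -/
def mapM₂ (f₀ : X → ℝ) (F : X → Z) (g : Z → EReal) (p : X × Z) : Set (X × Z) :=
  {q | (∃ y ∈ limitingSubdifferential g q.2,
      p.1 = gradient f₀ q.1 + ContinuousLinearMap.adjoint (fderiv ℝ F q.1) y) ∧
    p.2 = q.2 - F q.1}

/-- The qualification condition at `a`:
`F'(a)ᵀ y = 0` and `y ∈ ∂^∞ g(F(a))` imply `y = 0`. -/
def QualificationCondition (F : X → Z) (g : Z → EReal) (a : X) : Prop :=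
  ∀ y : Z, ContinuousLinearMap.adjoint (fderiv ℝ F a) y = 0 →
    y ∈ singularSubdifferential g (F a) → y = 0

end Model

end CompositeStability

end

open CompositeStability

namespace CompositeStability


/-! ### Transfer of Lipschitzian properties to a graphical extension -/

section Transfer

variable {V X Z : Type*}

/-! Near the reference point, `x ∈ M(v,u)` holds exactly when `(x, F x + u) ∈ M₂(v,u)`, and every
element of `M₂(v,u)` has second component `F x + u`. Locally, then, `gph M₂` is the image of `gph M`
under `(v,u,x) ↦ (v,u,x,F x + u)`. This map is locally Lipschitz because `F` is C¹, and its inverse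
on the image is a coordinate projection, so all four properties pass in both directions with
adjusted constants. The transfer lemmas use only this correspondence, recorded as `ExtendsAt`.

The correspondence is the chain rule `∂ₓf(x,u) = ∇f₀(x) + F'(x)ᵀ ∂g(F x + u)`. The inclusion `⊇`
follows from the subgradient inequality for convex `g`. For `⊆`, the epigraph of `f(·,u)` is the
preimage of `epi g` under the smooth map `(x,α) ↦ (F x + u, α - f₀ x)`. A penalty argument
approximates regular normals to such a preimage by images of normals to the convex set
(`exists_approx_normal_of_regularNormalCone_preimage`); the qualification condition keeps the
multipliers from escaping to infinity, so a limit can be taken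
(`exists_normal_of_limitingNormalCone_preimage`).

The condition is assumed only at `xbar` but needed at all nearby points. For convex `g` the singular
subgradients are the normals to the effective domain. That cone has closed graph without any
convergence of the values of `g`, so compactness of the unit sphere makes the condition stable
(`eventually_forall_convexNormalCone_eq_zero`). -/

/-- `T` extends `S` at `z` by the graph coordinate `w = F x + u`. -/
def ExtendsAt [Add Z] (S : V × Z → Set X) (T : V × Z → Set (X × Z)) (F : X → Z)
    (z : (V × Z) × X) : Prop :=
  z.2 ∈ S z.1 ↔ (z.2, F z.2 + z.1.2) ∈ T z.1

lemma mem_of_extendsAt [Add Z] {S : V × Z → Set X} {T : V × Z → Set (X × Z)} {F : X → Z}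
    (hT : ∀ p, ∀ q ∈ T p, q.2 = F q.1 + p.2) {p : V × Z} {q : X × Z}
    (h : ExtendsAt S T F (p, q.1)) (hq : q ∈ T p) : q.1 ∈ S p := by
  refine h.2 ?_
  have : (q.1, F q.1 + p.2) = q := by rw [← hT p q hq]
  simpa [this] using hq

variable [NormedAddCommGroup V] [NormedAddCommGroup X] [NormedAddCommGroup Z]
  {S : V × Z → Set X} {T : V × Z → Set (X × Z)} {F : X → Z}

/-- Since `w' - w = (F x' - F x) + (u' - u)`, the new coordinate costs at most `K * κ + 1`. The
bound depends only on `κ` and `K`, which gives a common constant for calmness around a point. -/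
lemma isolatedlyCalmAtWith_extension (hT : ∀ p, ∀ q ∈ T p, q.2 = F q.1 + p.2)
    {K : NNReal} {κ : ℝ} {p : V × Z} {x : X}
    (hloc : ∀ᶠ z in 𝓝 (p, x), ExtendsAt S T F z)
    (hF : ∃ s ∈ 𝓝 x, LipschitzOnWith K F s) (hκ : 0 < κ)
    (h : IsolatedlyCalmAtWith κ S p x) :
    IsolatedlyCalmAtWith (κ + K * κ + 1) T p (x, F x + p.2) := by
  obtain ⟨hmem, U, hU, hcalm⟩ := h
  obtain ⟨s, hs, hF⟩ := hF
  refine ⟨hloc.self_of_nhds.1 hmem, ?_⟩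
  obtain ⟨A, hA, B, hB, hAB⟩ := mem_nhds_prod_iff.1 hloc
  obtain ⟨δ, hδ, hδA⟩ := Metric.mem_nhds_iff.1 hA
  have hV : (U ∩ s ∩ B) ×ˢ (Set.univ : Set Z) ∩ Metric.ball (x, F x + p.2) δ ∈
      𝓝 (x, F x + p.2) :=
    inter_mem (prod_mem_nhds (inter_mem (inter_mem hU hs) hB) univ_mem)
      (Metric.ball_mem_nhds _ hδ)
  refine ⟨_, hV, ?_⟩
  rintro p' ⟨x', w'⟩ ⟨hq, ⟨⟨⟨hxU, hxs⟩, hxB⟩, -⟩, hball⟩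
  have hKκ : 0 ≤ (K : ℝ) * κ := by positivity
  by_cases hp : p' ∈ Metric.ball p δ
  · have hS : x' ∈ S p' :=
      mem_of_extendsAt hT (q := (x', w')) (hAB ⟨hδA hp, hxB⟩) hq
    have h1 : ‖x' - x‖ ≤ κ * ‖p' - p‖ := hcalm p' x' ⟨hS, hxU⟩
    have h2 : ‖F x' - F x‖ ≤ K * ‖x' - x‖ := by
      simpa [dist_eq_norm] using hF.dist_le_mul x' hxs x (mem_of_mem_nhds hs)
    have h3 : ‖p'.2 - p.2‖ ≤ ‖p' - p‖ := norm_snd_le (p' - p)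
    have hw : w' = F x' + p'.2 := hT p' _ hq
    have h4 : ‖w' - (F x + p.2)‖ ≤ ‖F x' - F x‖ + ‖p'.2 - p.2‖ := by
      rw [hw, show F x' + p'.2 - (F x + p.2) = (F x' - F x) + (p'.2 - p.2) by abel]
      exact norm_add_le _ _
    have h5 : (K : ℝ) * ‖x' - x‖ ≤ K * (κ * ‖p' - p‖) := by gcongr
    have h6 := norm_nonneg (p' - p)
    rw [Prod.norm_def]
    refine max_le ?_ ?_
    · change ‖x' - x‖ ≤ _
      nlinarith [mul_nonneg hKκ h6]
    · change ‖w' - (F x + p.2)‖ ≤ _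
      nlinarith [mul_nonneg hκ.le h6]
  -- The correspondence says nothing about distant parameters. There the estimate is free: the value
  -- moves by less than `δ`, the parameter by at least `δ`, and the constant is at least 1.
  · rw [Metric.mem_ball, dist_eq_norm, not_lt] at hp
    rw [Metric.mem_ball, dist_eq_norm] at hball
    nlinarith [mul_nonneg (add_nonneg hκ.le hKκ) (norm_nonneg (p' - p))]

/-- Projecting to `x` does not increase norms; the extra 1 in the constant only serves parameters
outside the ball where the correspondence is known. -/
lemma isolatedlyCalmAtWith_of_extension {κ : ℝ} {p : V × Z} {x : X}
    (hloc : ∀ᶠ z in 𝓝 (p, x), ExtendsAt S T F z) (hF : ContinuousAt F x) (hκ : 0 < κ)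
    (h : IsolatedlyCalmAtWith κ T p (x, F x + p.2)) :
    IsolatedlyCalmAtWith (κ + 1) S p x := by
  obtain ⟨hmem, U, hU, hcalm⟩ := h
  refine ⟨hloc.self_of_nhds.2 hmem, ?_⟩
  have hcont : ContinuousAt (fun z : (V × Z) × X => (z.2, F z.2 + z.1.2)) (p, x) :=
    continuousAt_snd.prodMk
      ((ContinuousAt.comp (f := Prod.snd) (x := (p, x)) hF continuousAt_snd).add
        (by fun_prop))
  obtain ⟨A, hA, B, hB, hAB⟩ := mem_nhds_prod_iff.1 (hloc.and (hcont.eventually hU))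
  obtain ⟨δ, hδ, hδA⟩ := Metric.mem_nhds_iff.1 hA
  refine ⟨_, inter_mem hB (Metric.ball_mem_nhds x hδ), ?_⟩
  rintro p' x' ⟨hS, hxB, hball⟩
  by_cases hp : p' ∈ Metric.ball p δ
  · obtain ⟨h1, h2⟩ := hAB (show (p', x') ∈ A ×ˢ B from ⟨hδA hp, hxB⟩)
    have h3 := hcalm p' _ ⟨h1.1 hS, h2⟩
    have h4 : ‖x' - x‖ ≤ ‖(x', F x' + p'.2) - (x, F x + p.2)‖ :=
      norm_fst_le ((x', F x' + p'.2) - (x, F x + p.2))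
    nlinarith [norm_nonneg (p' - p)]
  · rw [Metric.mem_ball, dist_eq_norm, not_lt] at hp
    rw [Metric.mem_ball, dist_eq_norm] at hball
    nlinarith [mul_nonneg hκ.le (norm_nonneg (p' - p))]

lemma isolatedlyCalmAt_iff_extension (hT : ∀ p, ∀ q ∈ T p, q.2 = F q.1 + p.2)
    {K : NNReal} {p : V × Z} {x : X}
    (hloc : ∀ᶠ z in 𝓝 (p, x), ExtendsAt S T F z)
    (hF : ∃ s ∈ 𝓝 x, LipschitzOnWith K F s) (hFc : Continuous F) :
    IsolatedlyCalmAt S p x ↔ IsolatedlyCalmAt T p (x, F x + p.2) := by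
  constructor
  · rintro ⟨κ, hκ, h⟩
    exact ⟨_, by positivity, isolatedlyCalmAtWith_extension hT hloc hF hκ h⟩
  · rintro ⟨κ, hκ, h⟩
    exact ⟨_, by positivity, isolatedlyCalmAtWith_of_extension hloc hFc.continuousAt hκ h⟩

lemma isolatedlyCalmAround_iff_extension (hT : ∀ p, ∀ q ∈ T p, q.2 = F q.1 + p.2)
    {K : NNReal} {p : V × Z} {x : X}
    (hloc : ∀ᶠ z in 𝓝 (p, x), ExtendsAt S T F z)
    (hF : ∃ s ∈ 𝓝 x, LipschitzOnWith K F s) (hFc : Continuous F) :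
    IsolatedlyCalmAround S p x ↔ IsolatedlyCalmAround T p (x, F x + p.2) := by
  constructor
  · rintro ⟨hmem, κ, hκ, W, hW, h⟩
    obtain ⟨s, hs, hF⟩ := hF
    -- The neighborhood retains points near which the correspondence still holds and for which the
    -- same set `s` is a neighborhood, so one pair `κ`, `K` serves them all.
    refine ⟨hloc.self_of_nhds.1 hmem, κ + K * κ + 1, by positivity,
      (fun z : (V × Z) × (X × Z) => (z.1, z.2.1)) ⁻¹'
        (W ∩ {z | ∀ᶠ z' in 𝓝 z, ExtendsAt S T F z'} ∩ {z | s ∈ 𝓝 z.2}), ?_, ?_⟩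
    · have hc : ContinuousAt (fun z : (V × Z) × (X × Z) => (z.1, z.2.1))
          (p, (x, F x + p.2)) := by fun_prop
      refine hc.preimage_mem_nhds (inter_mem (inter_mem hW ?_) ?_)
      · exact eventually_eventually_nhds.2 hloc
      · exact continuousAt_snd.eventually (eventually_mem_nhds_iff.2 hs)
    · rintro ⟨p', x', w'⟩ ⟨⟨⟨h1, h2⟩, h3⟩, h4⟩
      have hw : w' = F x' + p'.2 := hT p' _ h4
      subst hw
      have h5 : (p', x') ∈ gph S := h2.self_of_nhds.2 h4
      exact isolatedlyCalmAtWith_extension hT h2 ⟨s, h3, hF⟩ hκ (h _ ⟨h1, h5⟩)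
  · rintro ⟨hmem, κ, hκ, W, hW, h⟩
    refine ⟨hloc.self_of_nhds.2 hmem, κ + 1, by positivity,
      (fun z : (V × Z) × X => (z.1, (z.2, F z.2 + z.1.2))) ⁻¹' W ∩
        {z | ∀ᶠ z' in 𝓝 z, ExtendsAt S T F z'}, ?_, ?_⟩
    · have hc : Continuous (fun z : (V × Z) × X => (z.1, (z.2, F z.2 + z.1.2))) := by
        fun_prop
      exact inter_mem (hc.continuousAt.preimage_mem_nhds hW)
        (eventually_eventually_nhds.2 hloc)
    · rintro ⟨p', x'⟩ ⟨⟨h1, h2⟩, h3⟩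
      exact isolatedlyCalmAtWith_of_extension h2 hFc.continuousAt hκ
        (h _ ⟨h1, h2.self_of_nhds.1 h3⟩)

/-- Locally, `gph T` is the preimage of `gph S` under a continuous projection, cut by the closed
equation `w = F x + u`. -/
lemma locallyClosed_gph_extension (hT : ∀ p, ∀ q ∈ T p, q.2 = F q.1 + p.2)
    {p : V × Z} {x : X} (hloc : ∀ᶠ z in 𝓝 (p, x), ExtendsAt S T F z) (hFc : Continuous F)
    (h : ∃ W ∈ 𝓝 (p, x), IsClosed W ∧ IsClosed (W ∩ gph S)) :
    ∃ W ∈ 𝓝 (p, (x, F x + p.2)), IsClosed W ∧ IsClosed (W ∩ gph T) := by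
  obtain ⟨W, hW, hWc, hWS⟩ := h
  obtain ⟨r, hr, hball⟩ := Metric.nhds_basis_closedBall.mem_iff.1 hloc
  have hc : Continuous (fun z : (V × Z) × (X × Z) => (z.1, z.2.1)) := by fun_prop
  refine ⟨(fun z : (V × Z) × (X × Z) => (z.1, z.2.1)) ⁻¹' (W ∩ Metric.closedBall (p, x) r),
    hc.continuousAt.preimage_mem_nhds (inter_mem hW (Metric.closedBall_mem_nhds _ hr)),
    (hWc.inter Metric.isClosed_closedBall).preimage hc, ?_⟩
  have heq : (fun z : (V × Z) × (X × Z) => (z.1, z.2.1)) ⁻¹'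
      (W ∩ Metric.closedBall (p, x) r) ∩ gph T =
      (fun z : (V × Z) × (X × Z) => (z.1, z.2.1)) ⁻¹'
        ((W ∩ gph S) ∩ Metric.closedBall (p, x) r) ∩ {z | z.2.2 = F z.2.1 + z.1.2} := by
    ext ⟨p', x', w'⟩
    constructor
    · rintro ⟨⟨h1, h2⟩, h3⟩
      exact ⟨⟨⟨h1, mem_of_extendsAt hT (hball h2) h3⟩, h2⟩, hT p' _ h3⟩
    · rintro ⟨⟨⟨h1, h3⟩, h2⟩, h4⟩
      refine ⟨⟨h1, h2⟩, ?_⟩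
      have h4' : w' = F x' + p'.2 := h4
      subst h4'
      exact (hball h2).1 h3
  rw [heq]
  exact ((hWS.inter Metric.isClosed_closedBall).preimage hc).inter
    (isClosed_eq (by fun_prop) (by fun_prop))

lemma locallyClosed_gph_of_extension
    {p : V × Z} {x : X} (hloc : ∀ᶠ z in 𝓝 (p, x), ExtendsAt S T F z) (hFc : Continuous F)
    (h : ∃ W ∈ 𝓝 (p, (x, F x + p.2)), IsClosed W ∧ IsClosed (W ∩ gph T)) :
    ∃ W ∈ 𝓝 (p, x), IsClosed W ∧ IsClosed (W ∩ gph S) := by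
  obtain ⟨W, hW, hWc, hWT⟩ := h
  obtain ⟨r, hr, hball⟩ := Metric.nhds_basis_closedBall.mem_iff.1 hloc
  have hc : Continuous (fun z : (V × Z) × X => (z.1, (z.2, F z.2 + z.1.2))) := by fun_prop
  refine ⟨(fun z : (V × Z) × X => (z.1, (z.2, F z.2 + z.1.2))) ⁻¹' W ∩
      Metric.closedBall (p, x) r,
    inter_mem (hc.continuousAt.preimage_mem_nhds hW) (Metric.closedBall_mem_nhds _ hr),
    (hWc.preimage hc).inter Metric.isClosed_closedBall, ?_⟩
  have heq : (fun z : (V × Z) × X => (z.1, (z.2, F z.2 + z.1.2))) ⁻¹' W ∩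
      Metric.closedBall (p, x) r ∩ gph S =
      (fun z : (V × Z) × X => (z.1, (z.2, F z.2 + z.1.2))) ⁻¹' (W ∩ gph T) ∩
        Metric.closedBall (p, x) r := by
    ext z
    constructor
    · rintro ⟨⟨h1, h2⟩, h3⟩
      exact ⟨⟨h1, (hball h2).1 h3⟩, h2⟩
    · rintro ⟨⟨h1, h3⟩, h2⟩
      exact ⟨⟨h1, h2⟩, (hball h2).2 h3⟩
  rw [heq]
  exact (hWT.preimage hc).inter Metric.isClosed_closedBall

lemma aubinPropertyAt_extension (hT : ∀ p, ∀ q ∈ T p, q.2 = F q.1 + p.2)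
    {K : NNReal} {p : V × Z} {x : X}
    (hloc : ∀ᶠ z in 𝓝 (p, x), ExtendsAt S T F z)
    (hF : ∃ s ∈ 𝓝 x, LipschitzOnWith K F s) (hFc : Continuous F)
    (h : AubinPropertyAt S p x) : AubinPropertyAt T p (x, F x + p.2) := by
  obtain ⟨hmem, hcl, κ, hκ, U, hU, A, hA, hlip⟩ := h
  obtain ⟨s, hs, hF⟩ := hF
  refine ⟨hloc.self_of_nhds.1 hmem, locallyClosed_gph_extension hT hloc hFc hcl,
    κ + K * κ + 1, by positivity, ?_⟩
  obtain ⟨P, hP, B, hB, hPB⟩ := mem_nhds_prod_iff.1 hloc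
  obtain ⟨r, hr, hrB⟩ := Metric.mem_nhds_iff.1 (inter_mem hB hs)
  -- The Aubin property does not localize the point `x₁` it provides. With parameters at most `2 *
  -- δ` apart, `x₁` lies within `r / 2` of `x₂`, hence in the ball of radius `r` where the
  -- correspondence and the Lipschitz bound apply.
  obtain ⟨δ, hδ, hδr⟩ : ∃ δ : ℝ, 0 < δ ∧ κ * (2 * δ) ≤ r / 2 :=
    ⟨r / (4 * κ), by positivity, le_of_eq (by field_simp; ring)⟩
  refine ⟨U ∩ P ∩ Metric.ball p δ,
    inter_mem (inter_mem hU hP) (Metric.ball_mem_nhds _ hδ),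
    (A ∩ Metric.ball x (r / 2)) ×ˢ Set.univ,
    prod_mem_nhds (inter_mem hA (Metric.ball_mem_nhds _ (by positivity))) univ_mem, ?_⟩
  rintro p₁ ⟨⟨hU1, hP1⟩, hδ1⟩ p₂ ⟨⟨hU2, hP2⟩, hδ2⟩ ⟨x₂, w₂⟩ ⟨hq, ⟨hA2, hball⟩, -⟩
  change x₂ ∈ A at hA2
  change x₂ ∈ Metric.ball x (r / 2) at hball
  have hx2 : x₂ ∈ B ∩ s := hrB (Metric.ball_subset_ball (by linarith) hball)
  have hS2 : x₂ ∈ S p₂ := mem_of_extendsAt hT (q := (x₂, w₂)) (hPB ⟨hP2, hx2.1⟩) hq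
  obtain ⟨x₁, hS1, hx⟩ := hlip p₁ hU1 p₂ hU2 x₂ ⟨hS2, hA2⟩
  have hpp : ‖p₂ - p₁‖ ≤ 2 * δ := by
    rw [← dist_eq_norm]
    rw [Metric.mem_ball] at hδ1 hδ2
    linarith [dist_triangle_right p₂ p₁ p]
  have hx1 : x₁ ∈ B ∩ s := by
    apply hrB
    rw [Metric.mem_ball] at hball ⊢
    have h1 : dist x₂ x₁ ≤ κ * (2 * δ) := by
      rw [dist_eq_norm]
      exact hx.trans (by gcongr)
    linarith [dist_triangle_left x₁ x x₂]
  refine ⟨(x₁, F x₁ + p₁.2), (hPB ⟨hP1, hx1.1⟩ : ExtendsAt S T F (p₁, x₁)).1 hS1, ?_⟩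
  have hw : w₂ = F x₂ + p₂.2 := hT p₂ _ hq
  have h2 : ‖F x₂ - F x₁‖ ≤ K * ‖x₂ - x₁‖ := by
    simpa [dist_eq_norm] using hF.dist_le_mul x₂ hx2.2 x₁ hx1.2
  have h3 : ‖p₂.2 - p₁.2‖ ≤ ‖p₂ - p₁‖ := norm_snd_le (p₂ - p₁)
  have h4 : ‖w₂ - (F x₁ + p₁.2)‖ ≤ ‖F x₂ - F x₁‖ + ‖p₂.2 - p₁.2‖ := by
    rw [hw, show F x₂ + p₂.2 - (F x₁ + p₁.2) = (F x₂ - F x₁) + (p₂.2 - p₁.2) by abel]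
    exact norm_add_le _ _
  have h5 : (K : ℝ) * ‖x₂ - x₁‖ ≤ K * (κ * ‖p₂ - p₁‖) := by gcongr
  have h6 := norm_nonneg (p₂ - p₁)
  have hKκ : 0 ≤ (K : ℝ) * κ := by positivity
  rw [Prod.norm_def]
  refine max_le ?_ ?_
  · change ‖x₂ - x₁‖ ≤ _
    nlinarith [mul_nonneg hKκ h6]
  · change ‖w₂ - (F x₁ + p₁.2)‖ ≤ _
    nlinarith [mul_nonneg hκ.le h6]

/-- The constant `κ` is kept because the projection to `x` is nonexpansive; the radius `δ` again
keeps the selected point where the graphs correspond. -/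
lemma aubinPropertyAt_of_extension (hT : ∀ p, ∀ q ∈ T p, q.2 = F q.1 + p.2)
    {p : V × Z} {x : X}
    (hloc : ∀ᶠ z in 𝓝 (p, x), ExtendsAt S T F z) (hFc : Continuous F)
    (h : AubinPropertyAt T p (x, F x + p.2)) : AubinPropertyAt S p x := by
  obtain ⟨hmem, hcl, κ, hκ, U, hU, A, hA, hlip⟩ := h
  refine ⟨hloc.self_of_nhds.2 hmem, locallyClosed_gph_of_extension hloc hFc hcl, κ, hκ, ?_⟩
  have hcont : Continuous (fun z : (V × Z) × X => (z.2, F z.2 + z.1.2)) := by fun_prop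
  obtain ⟨P, hP, B, hB, hPB⟩ :=
    mem_nhds_prod_iff.1 (hloc.and (hcont.continuousAt.eventually hA))
  obtain ⟨r, hr, hrB⟩ := Metric.mem_nhds_iff.1 hB
  obtain ⟨δ, hδ, hδr⟩ : ∃ δ : ℝ, 0 < δ ∧ κ * (2 * δ) ≤ r / 2 :=
    ⟨r / (4 * κ), by positivity, le_of_eq (by field_simp; ring)⟩
  refine ⟨U ∩ P ∩ Metric.ball p δ,
    inter_mem (inter_mem hU hP) (Metric.ball_mem_nhds _ hδ),
    Metric.ball x (r / 2), Metric.ball_mem_nhds _ (by positivity), ?_⟩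
  rintro p₁ ⟨⟨hU1, hP1⟩, hδ1⟩ p₂ ⟨⟨hU2, hP2⟩, hδ2⟩ x₂ ⟨hS2, hball⟩
  have hx2 : x₂ ∈ B := hrB (Metric.ball_subset_ball (by linarith) hball)
  obtain ⟨h1, h2⟩ := hPB (show (p₂, x₂) ∈ P ×ˢ B from ⟨hP2, hx2⟩)
  obtain ⟨⟨x₁, w₁⟩, hT1, hx⟩ := hlip p₁ hU1 p₂ hU2 _ ⟨h1.1 hS2, h2⟩
  have hx' : ‖x₂ - x₁‖ ≤ κ * ‖p₂ - p₁‖ :=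
    (norm_fst_le ((x₂, F x₂ + p₂.2) - (x₁, w₁))).trans hx
  have hpp : ‖p₂ - p₁‖ ≤ 2 * δ := by
    rw [← dist_eq_norm]
    rw [Metric.mem_ball] at hδ1 hδ2
    linarith [dist_triangle_right p₂ p₁ p]
  have hx1 : x₁ ∈ B := by
    apply hrB
    rw [Metric.mem_ball] at hball ⊢
    have h1 : dist x₂ x₁ ≤ κ * (2 * δ) := by
      rw [dist_eq_norm]
      exact hx'.trans (by gcongr)
    linarith [dist_triangle_left x₁ x x₂]
  exact ⟨x₁, mem_of_extendsAt hT (q := (x₁, w₁))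
    (hPB (show (p₁, x₁) ∈ P ×ˢ B from ⟨hP1, hx1⟩)).1 hT1, hx'⟩

lemma hasLipschitzLocalization_extension (hT : ∀ p, ∀ q ∈ T p, q.2 = F q.1 + p.2)
    {p : V × Z} {x : X}
    (hloc : ∀ᶠ z in 𝓝 (p, x), ExtendsAt S T F z) (hF : LocallyLipschitz F)
    (h : HasLipschitzLocalization S p x) : HasLipschitzLocalization T p (x, F x + p.2) := by
  obtain ⟨U, hU, A, hA, σ, hσ, hσp, hgph⟩ := h
  obtain ⟨P, hP, B, hB, hPB⟩ := mem_nhds_prod_iff.1 hloc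
  have hσc : ContinuousAt σ p := hσ.continuousOn.continuousAt hU
  -- Continuity of `σ` allows the parameter set to shrink until all its values lie where the two
  -- graphs correspond.
  have hσB : ∀ᶠ p' in 𝓝 p, σ p' ∈ B := hσc.eventually (by rwa [hσp])
  have hsub : U ∩ P ∩ {p' | σ p' ∈ B} ⊆ U := fun _ h => h.1.1
  refine ⟨U ∩ P ∩ {p' | σ p' ∈ B}, inter_mem (inter_mem hU hP) hσB,
    (A ∩ B) ×ˢ Set.univ, prod_mem_nhds (inter_mem hA hB) univ_mem,
    fun p' => (σ p', F (σ p') + p'.2), ?_, by simp [hσp], ?_⟩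
  · intro a ha
    obtain ⟨K₁, t, ht, h1⟩ := hσ ha.1.1
    obtain ⟨K₂, s, hs, h2⟩ := hF (σ a)
    have ht' : t ∈ 𝓝[U ∩ P ∩ {p' | σ p' ∈ B}] a := nhdsWithin_mono a hsub ht
    have hs' : σ ⁻¹' s ∈ 𝓝[U ∩ P ∩ {p' | σ p' ∈ B}] a :=
      nhdsWithin_mono a hsub ((hσ.continuousOn a ha.1.1).preimage_mem_nhdsWithin hs)
    have h3 : LipschitzOnWith K₁ σ (t ∩ σ ⁻¹' s) := h1.mono Set.inter_subset_left
    have h4 : LipschitzOnWith (K₂ * K₁) (F ∘ σ) (t ∩ σ ⁻¹' s) :=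
      h2.comp h3 (fun _ h => h.2)
    have h5 : LipschitzOnWith 1 (Prod.snd : V × Z → Z) (t ∩ σ ⁻¹' s) :=
      LipschitzWith.prod_snd.lipschitzOnWith
    exact ⟨_, _, inter_mem ht' hs', h3.prodMk (h4.add h5)⟩
  · ext ⟨p', x', w'⟩
    constructor
    · rintro ⟨⟨⟨⟨h1, h2⟩, h3⟩, ⟨h4, h5⟩, -⟩, h6⟩
      have hS : x' ∈ S p' := mem_of_extendsAt hT (q := (x', w')) (hPB ⟨h2, h5⟩) h6
      have hx : x' = σ p' := by
        have : (p', x') ∈ (U ×ˢ A) ∩ gph S := ⟨⟨h1, h4⟩, hS⟩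
        rw [hgph] at this
        exact this.2
      have hw : w' = F x' + p'.2 := hT p' _ h6
      exact ⟨⟨⟨h1, h2⟩, h3⟩, by simp [hw, hx]⟩
    · rintro ⟨⟨⟨h1, h2⟩, h3⟩, h4⟩
      have h5 : (p', σ p') ∈ (U ×ˢ A) ∩ gph S := by
        rw [hgph]
        exact ⟨h1, rfl⟩
      have h4' : (x', w') = (σ p', F (σ p') + p'.2) := h4
      obtain ⟨rfl, rfl⟩ := Prod.mk.inj h4'
      exact ⟨⟨⟨⟨h1, h2⟩, h3⟩, ⟨h5.1.2, h3⟩, trivial⟩,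
        (hPB (show (p', σ p') ∈ P ×ˢ B from ⟨h2, h3⟩) : ExtendsAt S T F _).1 h5.2⟩

lemma hasLipschitzLocalization_of_extension (hT : ∀ p, ∀ q ∈ T p, q.2 = F q.1 + p.2)
    {p : V × Z} {x : X}
    (hloc : ∀ᶠ z in 𝓝 (p, x), ExtendsAt S T F z) (hFc : Continuous F)
    (h : HasLipschitzLocalization T p (x, F x + p.2)) : HasLipschitzLocalization S p x := by
  obtain ⟨U, hU, A, hA, σ, hσ, hσp, hgph⟩ := h
  have hcont : Continuous (fun z : (V × Z) × X => (z.2, F z.2 + z.1.2)) := by fun_prop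
  obtain ⟨P, hP, B, hB, hPB⟩ :=
    mem_nhds_prod_iff.1 (hloc.and (hcont.continuousAt.eventually hA))
  have hσc : ContinuousAt σ p := hσ.continuousOn.continuousAt hU
  have hσB : ∀ᶠ p' in 𝓝 p, (σ p').1 ∈ B :=
    (continuousAt_fst.comp hσc).eventually (by simpa [hσp] using hB)
  have hsub : U ∩ P ∩ {p' | (σ p').1 ∈ B} ⊆ U := fun _ h => h.1.1
  refine ⟨U ∩ P ∩ {p' | (σ p').1 ∈ B}, inter_mem (inter_mem hU hP) hσB, B, hB,
    fun p' => (σ p').1, ?_, by simp [hσp], ?_⟩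
  · intro a ha
    obtain ⟨K₁, t, ht, h1⟩ := hσ ha.1.1
    exact ⟨_, t, nhdsWithin_mono a hsub ht, LipschitzWith.prod_fst.comp_lipschitzOnWith h1⟩
  · ext ⟨p', x'⟩
    constructor
    · rintro ⟨⟨⟨⟨h1, h2⟩, h3⟩, h5⟩, h6⟩
      obtain ⟨h7, h8⟩ := hPB (show (p', x') ∈ P ×ˢ B from ⟨h2, h5⟩)
      have : (p', (x', F x' + p'.2)) ∈ (U ×ˢ A) ∩ gph T := ⟨⟨h1, h8⟩, h7.1 h6⟩
      rw [hgph] at this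
      exact ⟨⟨⟨h1, h2⟩, h3⟩, congrArg Prod.fst this.2⟩
    · rintro ⟨⟨⟨h1, h2⟩, h3⟩, h4⟩
      have h5 : (p', σ p') ∈ (U ×ˢ A) ∩ gph T := by
        rw [hgph]
        exact ⟨h1, rfl⟩
      have h4' : x' = (σ p').1 := h4
      subst h4'
      exact ⟨⟨⟨⟨h1, h2⟩, h3⟩, h3⟩, mem_of_extendsAt hT
        (hPB (show (p', (σ p').1) ∈ P ×ˢ B from ⟨h2, h3⟩)).1 h5.2⟩

end Transfer


/-! ### Normal cones to convex sets -/

section ConvexNormals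

variable {H : Type*} [NormedAddCommGroup H] [InnerProductSpace ℝ H]

/-- The normal cone of convex analysis. -/
def convexNormalCone (C : Set H) (a : H) : Set H :=
  {η | ∀ c ∈ C, inner ℝ η (c - a) ≤ 0}

lemma smul_mem_convexNormalCone {C : Set H} {a η : H} (hη : η ∈ convexNormalCone C a) {r : ℝ}
    (hr : 0 ≤ r) : r • η ∈ convexNormalCone C a := by
  intro c hc
  rw [real_inner_smul_left]
  exact mul_nonpos_of_nonneg_of_nonpos hr (hη c hc)

/-- The defining inequalities are closed conditions. Neither convexity of `C` nor membership of the
base points is required, which suits the later limits. -/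
lemma convexNormalCone_of_tendsto {C : Set H} {a η : H} {x ξ : ℕ → H}
    (hx : Tendsto x atTop (𝓝 a)) (hξ : Tendsto ξ atTop (𝓝 η))
    (h : ∀ k, ξ k ∈ convexNormalCone C (x k)) : η ∈ convexNormalCone C a := fun c hc =>
  le_of_tendsto (hξ.inner (tendsto_const_nhds.sub hx)) (Eventually.of_forall fun k => h k c hc)

lemma convexNormalCone_subset_regularNormalCone (C : Set H) (a : H) :
    convexNormalCone C a ⊆ regularNormalCone C a := by
  intro η hη ε hε
  filter_upwards [self_mem_nhdsWithin] with x hx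
  exact (hη x hx).trans (by positivity)

/-- Convexity keeps the segment from `a` to `c` in `C`. Apply the regular normal inequality along
it, divide by the step length `t`, and let `ε` tend to zero. -/
lemma regularNormalCone_subset_convexNormalCone {C : Set H} (hC : Convex ℝ C) {a : H}
    (ha : a ∈ C) : regularNormalCone C a ⊆ convexNormalCone C a := by
  intro η hη c hc
  have key : ∀ ε : ℝ, 0 < ε → inner ℝ η (c - a) ≤ ε * ‖c - a‖ := by
    intro ε hε
    have hlim : Tendsto (fun t : ℝ => a + t • (c - a)) (𝓝[>] 0) (𝓝[C] a) := by
      refine tendsto_nhdsWithin_iff.2 ⟨?_, ?_⟩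
      · have : Tendsto (fun t : ℝ => a + t • (c - a)) (𝓝 0) (𝓝 (a + (0 : ℝ) • (c - a))) :=
          (Continuous.tendsto (by fun_prop) 0)
        simp only [zero_smul, add_zero] at this
        exact this.mono_left nhdsWithin_le_nhds
      · filter_upwards [Ioo_mem_nhdsGT (zero_lt_one' ℝ)] with t ht
        exact hC.add_smul_sub_mem ha hc ⟨ht.1.le, ht.2.le⟩
    obtain ⟨t, ht, ht0⟩ := ((hlim.eventually (hη ε hε)).and self_mem_nhdsWithin).exists
    have ht0' : 0 < t := ht0
    rw [add_sub_cancel_left, real_inner_smul_right, norm_smul, Real.norm_of_nonneg ht0'.le]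
      at ht
    nlinarith
  refine le_of_forall_pos_le_add fun δ hδ => ?_
  have h1 := key (δ / (‖c - a‖ + 1)) (by positivity)
  have h2 : δ / (‖c - a‖ + 1) * ‖c - a‖ ≤ δ := by
    rw [div_mul_eq_mul_div, div_le_iff₀ (by positivity)]
    nlinarith
  linarith

lemma limitingNormalCone_eq_convexNormalCone {C : Set H} (hC : Convex ℝ C) {a : H}
    (ha : a ∈ C) : limitingNormalCone C a = convexNormalCone C a := by
  ext η
  constructor
  · rintro ⟨x, ξ, hx, hξ, h⟩
    exact convexNormalCone_of_tendsto hx hξ fun k =>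
      regularNormalCone_subset_convexNormalCone hC (h k).1 (h k).2
  · intro hη
    exact ⟨fun _ => a, fun _ => η, tendsto_const_nhds, tendsto_const_nhds, fun _ =>
      ⟨ha, convexNormalCone_subset_regularNormalCone C a hη⟩⟩

end ConvexNormals

/-! ### Normals to preimages of convex sets -/

section Preimage

variable {E H : Type*} [NormedAddCommGroup E] [InnerProductSpace ℝ E] [FiniteDimensional ℝ E]
  [NormedAddCommGroup H] [InnerProductSpace ℝ H] [FiniteDimensional ℝ H]

omit [FiniteDimensional ℝ E] in
-- An approximate Fermat rule: one-sided difference quotients bound the derivative below by `-ε *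
-- ‖d‖`, and replacing `d` by `-d` gives the upper bound.
lemma abs_fderiv_le_of_eventually_le {s : E → ℝ} {s' : E →L[ℝ] ℝ} {q : E} {ε : ℝ}
    (hs : HasFDerivAt s s' q) (h : ∀ᶠ x in 𝓝 q, s q ≤ s x + ε * ‖x - q‖) (d : E) :
    |s' d| ≤ ε * ‖d‖ := by
  have key : ∀ d : E, -(ε * ‖d‖) ≤ s' d := by
    intro d
    have h0 : HasDerivAt (fun t : ℝ => s (q + t • d)) (s' d) 0 := hs.hasLineDerivAt d
    have h1 := h0.tendsto_slope_zero_right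
    have h2 : Tendsto (fun t : ℝ => q + t • d) (𝓝[>] 0) (𝓝 q) := by
      have : Tendsto (fun t : ℝ => q + t • d) (𝓝 0) (𝓝 (q + (0 : ℝ) • d)) :=
        Continuous.tendsto (by fun_prop) 0
      simp only [zero_smul, add_zero] at this
      exact this.mono_left nhdsWithin_le_nhds
    refine ge_of_tendsto h1 ?_
    filter_upwards [h2.eventually h, self_mem_nhdsWithin] with t ht ht0
    have ht0' : 0 < t := ht0
    rw [add_sub_cancel_left, norm_smul, Real.norm_of_nonneg ht0'.le] at ht
    simp only [zero_add, zero_smul, add_zero, smul_eq_mul]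
    rw [inv_mul_eq_div, le_div_iff₀ ht0']
    linarith
  refine abs_le.2 ⟨key d, ?_⟩
  have := key (-d)
  rw [norm_neg, map_neg] at this
  linarith

/-- Regular normals to the preimage of a closed convex set are approximated by images of normals
to the set at nearby points; no qualification condition is needed. -/
lemma exists_approx_normal_of_regularNormalCone_preimage {G : E → H} (hG : Differentiable ℝ G)
    {C : Set H} (hCc : IsClosed C) (hC : Convex ℝ C) {p v : E} (hp : G p ∈ C)
    (hv : v ∈ regularNormalCone (G ⁻¹' C) p) {ε : ℝ} (hε : 0 < ε) :
    ∃ q : E, ∃ c : H, ∃ η ∈ convexNormalCone C c, dist q p < ε ∧ dist c (G p) < ε ∧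
      ∀ d, |inner ℝ v d - inner ℝ η (fderiv ℝ G q d)| ≤ ε * ‖d‖ := by
  have : ProperSpace E := FiniteDimensional.proper ℝ E
  have : ProperSpace H := FiniteDimensional.proper ℝ H
  have hGc : Continuous G := hG.continuous
  have hne : C.Nonempty := ⟨_, hp⟩
  obtain ⟨δ₀, hδ₀, hreg⟩ :=
    Metric.nhds_basis_closedBall.mem_iff.1
      (eventually_nhdsWithin_iff.1 (hv (ε / 2) (by positivity)))
  obtain ⟨δ, hδ, hδ₀', hδε⟩ : ∃ δ : ℝ, 0 < δ ∧ δ ≤ δ₀ ∧ δ < ε :=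
    ⟨min δ₀ (ε / 2), by positivity, min_le_left _ _, (min_le_right _ _).trans_lt (by linarith)⟩
  -- Quadratic penalization of `G q ∈ C`: as the weight `k` grows, minimizers over the ball become
  -- feasible in the limit.
  set ψ : ℕ → E → ℝ := fun k q =>
    -inner ℝ v (q - p) + ε * ‖q - p‖ + k * Metric.infDist (G q) C ^ 2 with hψ
  have hmin : ∀ k, ∃ q ∈ Metric.closedBall p δ, IsMinOn (ψ k) (Metric.closedBall p δ) q := by
    intro k
    refine (isCompact_closedBall p δ).exists_isMinOn
      ⟨p, Metric.mem_closedBall_self hδ.le⟩ (Continuous.continuousOn ?_)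
    have := (Metric.continuous_infDist_pt C).comp hGc
    simp only [Function.comp_def] at this
    fun_prop
  choose q hqb hqmin using hmin
  have hψle : ∀ k, ψ k (q k) ≤ 0 := by
    intro k
    have h1 := hqmin k (Metric.mem_closedBall_self hδ.le)
    have h2 : ψ k p = 0 := by simp [hψ, Metric.infDist_zero_of_mem hp]
    exact h1.trans h2.le
  obtain ⟨qs, hqs, φ, hφ, hlim⟩ := (isCompact_closedBall p δ).tendsto_subseq hqb
  have hinner : ∀ k, inner ℝ v (q k - p) ≤ ‖v‖ * δ := fun k =>
    (real_inner_le_norm _ _).trans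
      (by have := hqb k; rw [mem_closedBall_iff_norm] at this; gcongr)
  have hdist : Tendsto (fun k => Metric.infDist (G (q (φ k))) C ^ 2) atTop (𝓝 0) := by
    have h1 : Tendsto (fun k => ‖v‖ * δ / (φ k : ℝ)) atTop (𝓝 0) :=
      tendsto_const_nhds.div_atTop (tendsto_natCast_atTop_atTop.comp hφ.tendsto_atTop)
    refine squeeze_zero' (Eventually.of_forall fun k => sq_nonneg _) ?_ h1
    filter_upwards [eventually_gt_atTop 0] with k hk
    have hk' : (0 : ℝ) < φ k := by exact_mod_cast hk.trans_le (hφ.id_le k)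
    rw [le_div_iff₀ hk']
    have h2 := hψle (φ k)
    have h3 := hinner (φ k)
    simp only [hψ] at h2
    nlinarith [mul_nonneg hε.le (norm_nonneg (q (φ k) - p))]
  have hqsC : G qs ∈ C := by
    have h1 : Tendsto (fun k => Metric.infDist (G (q (φ k))) C ^ 2) atTop
        (𝓝 (Metric.infDist (G qs) C ^ 2)) :=
      ((((Metric.continuous_infDist_pt C).comp hGc).tendsto qs).comp hlim).pow 2
    have h2 : Metric.infDist (G qs) C = 0 :=
      pow_eq_zero_iff two_ne_zero |>.1 (tendsto_nhds_unique h1 hdist)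
    exact (hCc.mem_iff_infDist_zero hne).2 h2
  -- The regular normal was used with `ε / 2`, the penalty with `ε`. Feasibility of `qs` gives `ε *
  -- ‖qs - p‖ ≤ ⟪v, qs - p⟫ ≤ (ε / 2) * ‖qs - p‖`, which forces `qs = p`.
  have hqsp : qs = p := by
    have h1 : inner ℝ v (qs - p) ≤ ε / 2 * ‖qs - p‖ :=
      hreg (Metric.closedBall_subset_closedBall hδ₀' hqs) hqsC
    have h2 : -inner ℝ v (qs - p) + ε * ‖qs - p‖ ≤ 0 := by
      have hc : Continuous fun x : E => -inner ℝ v (x - p) + ε * ‖x - p‖ := by fun_prop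
      refine le_of_tendsto ((hc.tendsto qs).comp hlim) (Eventually.of_forall fun k => ?_)
      have h3 := hψle (φ k)
      have h4 : 0 ≤ (φ k : ℝ) * Metric.infDist (G (q (φ k))) C ^ 2 := by positivity
      simp only [hψ] at h3
      simp only [Function.comp_apply]
      linarith
    have h3 : ‖qs - p‖ ≤ 0 := by nlinarith [norm_nonneg (qs - p)]
    exact sub_eq_zero.1 (norm_le_zero_iff.1 h3)
  rw [hqsp] at hlim
  obtain ⟨j, hj1, hj2⟩ :=
    ((hlim.eventually (Metric.ball_mem_nhds p hδ)).and
      (((hGc.tendsto p).comp hlim).eventually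
        (Metric.ball_mem_nhds (G p) (half_pos hε)))).exists
  set k := φ j
  simp only [Function.comp_apply] at hj1 hj2
  obtain ⟨c, hcC, hc⟩ := hCc.exists_infDist_eq_dist hne (G (q k))
  have hcle : ∀ c' ∈ C, ‖G (q k) - c‖ ≤ ‖G (q k) - c'‖ := by
    intro c' hc'
    rw [← dist_eq_norm, ← dist_eq_norm, ← hc]
    exact Metric.infDist_le_dist_of_mem hc'
  have hnormal : G (q k) - c ∈ convexNormalCone C c := by
    refine (norm_eq_iInf_iff_real_inner_le_zero hC hcC).1 (le_antisymm ?_ ?_)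
    · have : Nonempty C := ⟨⟨c, hcC⟩⟩
      exact le_ciInf fun w => hcle w w.2
    · exact ciInf_le (f := fun w : C => ‖G (q k) - w‖)
        ⟨0, by rintro _ ⟨w, rfl⟩; exact norm_nonneg _⟩ ⟨c, hcC⟩
  -- The multiplier is the gradient of `k * ‖· - c‖ ^ 2` at `G (q k)`, a nonnegative multiple of the
  -- projection residual.
  refine ⟨q k, c, (2 * (k : ℝ)) • (G (q k) - c),
    smul_mem_convexNormalCone hnormal (by positivity), hj1.trans hδε, ?_, ?_⟩
  · have h1 : dist (G (q k)) c ≤ dist (G (q k)) (G p) := by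
      rw [← hc]
      exact Metric.infDist_le_dist_of_mem hp
    linarith [dist_triangle_left c (G p) (G (q k))]
  · intro d
    -- With `c` frozen, `‖G x - c‖ ^ 2` majorizes the squared distance and agrees with it at `q k`,
    -- so no derivative of the distance is needed. The possibly nonsmooth term `ε * ‖x - p‖` is left
    -- out and becomes the error in the Fermat rule.
    have hder : HasFDerivAt (fun x => -inner ℝ v (x - p) + (k : ℝ) * ‖G x - c‖ ^ 2)
        (-(innerSL ℝ v) +
          (k : ℝ) • (2 • (innerSL ℝ (G (q k) - c)).comp (fderiv ℝ G (q k)))) (q k) := by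
      refine HasFDerivAt.add (HasFDerivAt.neg ?_) (HasFDerivAt.const_mul ?_ _)
      · exact (innerSL ℝ v).hasFDerivAt.comp (q k) ((hasFDerivAt_id (q k)).sub_const p)
      · exact ((hG (q k)).hasFDerivAt.sub_const c).norm_sq
    have h := abs_fderiv_le_of_eventually_le (ε := ε) hder ?_ d
    · rw [← abs_neg]
      convert h using 2
      simp [real_inner_smul_left, inner_sub_left]
      ring
    · filter_upwards [Metric.isOpen_ball.mem_nhds hj1] with x hx
      have h1 := hqmin k (Metric.ball_subset_closedBall hx)
      simp only [hψ, Set.mem_ofPred_eq] at h1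
      have h2 : Metric.infDist (G x) C ≤ ‖G x - c‖ := by
        rw [← dist_eq_norm]
        exact Metric.infDist_le_dist_of_mem hcC
      rw [hc, dist_eq_norm (G (q k)) c] at h1
      have h3 : (k : ℝ) * Metric.infDist (G x) C ^ 2 ≤ k * ‖G x - c‖ ^ 2 := by
        have := Metric.infDist_nonneg (x := G x) (s := C)
        gcongr
      have h4 : ‖x - p‖ ≤ ‖x - q k‖ + ‖q k - p‖ := by
        simpa using norm_add_le (x - q k) (q k - p)
      nlinarith

/-- Limiting normals to the preimage of a closed convex set under a qualification condition. -/
lemma exists_normal_of_limitingNormalCone_preimage {G : E → H} (hG : ContDiff ℝ 1 G)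
    {C : Set H} (hCc : IsClosed C) (hC : Convex ℝ C) {p v : E}
    (hCQ : ∀ η ∈ convexNormalCone C (G p), (∀ d, inner ℝ η (fderiv ℝ G p d) = 0) → η = 0)
    (hv : v ∈ limitingNormalCone (G ⁻¹' C) p) :
    ∃ η ∈ convexNormalCone C (G p), ∀ d, inner ℝ v d = inner ℝ η (fderiv ℝ G p d) := by
  have : ProperSpace H := FiniteDimensional.proper ℝ H
  obtain ⟨x, ξ, hx, hξ, h⟩ := hv
  have happrox := fun k : ℕ => exists_approx_normal_of_regularNormalCone_preimage
    (hG.differentiable one_ne_zero) hCc hC (h k).1 (h k).2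
    (ε := 1 / ((k : ℝ) + 1)) (by positivity)
  choose q c η hη hqx hcx hineq using happrox
  have hε : Tendsto (fun k : ℕ => 1 / ((k : ℝ) + 1)) atTop (𝓝 0) :=
    tendsto_one_div_add_atTop_nhds_zero_nat
  have hq : Tendsto q atTop (𝓝 p) :=
    (tendsto_iff_of_dist (squeeze_zero (fun _ => dist_nonneg) (fun k => (hqx k).le) hε)).2 hx
  have hc : Tendsto c atTop (𝓝 (G p)) :=
    (tendsto_iff_of_dist (squeeze_zero (fun _ => dist_nonneg) (fun k => (hcx k).le) hε)).2
      ((hG.continuous.tendsto p).comp hx)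
  have hG' : Tendsto (fun k => fderiv ℝ G (q k)) atTop (𝓝 (fderiv ℝ G p)) :=
    ((hG.continuous_fderiv one_ne_zero).tendsto p).comp hq
  have hdiff : ∀ d, Tendsto (fun k => inner ℝ (ξ k) d - inner ℝ (η k) (fderiv ℝ G (q k) d))
      atTop (𝓝 0) := fun d =>
    squeeze_zero_norm (fun k => hineq k d) (by simpa using hε.mul_const ‖d‖)
  have hinner : ∀ d, Tendsto (fun k => inner ℝ (ξ k) d) atTop (𝓝 (inner ℝ v d)) := fun d =>
    hξ.inner tendsto_const_nhds
  have hderiv : ∀ d, Tendsto (fun k => inner ℝ (η k) (fderiv ℝ G (q k) d)) atTop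
      (𝓝 (inner ℝ v d)) := fun d => by
    simpa using (hinner d).sub (hdiff d)
  have happly : ∀ d, Tendsto (fun k => fderiv ℝ G (q k) d) atTop (𝓝 (fderiv ℝ G p d)) :=
    fun d => ((ContinuousLinearMap.apply ℝ H d).continuous.tendsto _).comp hG'
  -- A bounded subsequence of multipliers has a limit with the required properties. Otherwise the
  -- norms diverge, and the normalized multipliers yield a unit normal annihilated by the
  -- derivative, contrary to `hCQ`.
  by_cases hb : ∃ R : ℝ, ∃ᶠ k in atTop, ‖η k‖ ≤ R
  · obtain ⟨R, hR⟩ := hb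
    obtain ⟨e, -, φ, hφ, hlim⟩ := tendsto_subseq_of_frequently_bounded
      (Metric.isBounded_closedBall (x := (0 : H)) (r := R))
      (hR.mono fun k hk => mem_closedBall_zero_iff.2 hk)
    refine ⟨e, convexNormalCone_of_tendsto (hc.comp hφ.tendsto_atTop) hlim fun k => hη _,
      fun d => ?_⟩
    exact tendsto_nhds_unique ((hderiv d).comp hφ.tendsto_atTop)
      (hlim.inner ((happly d).comp hφ.tendsto_atTop))
  · exfalso
    push Not at hb
    have hatTop : Tendsto (fun k => ‖η k‖) atTop atTop :=
      tendsto_atTop.2 fun R => (hb R).mono fun k hk => hk.le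
    have hsphere : ∃ᶠ k in atTop, ‖η k‖⁻¹ • η k ∈ Metric.sphere (0 : H) 1 := by
      refine Eventually.frequently ?_
      filter_upwards [hatTop.eventually_gt_atTop 0] with k hk
      rw [mem_sphere_zero_iff_norm, norm_smul, norm_inv, norm_norm, inv_mul_cancel₀ hk.ne']
    obtain ⟨e, he, φ, hφ, hlim⟩ := (isCompact_sphere (0 : H) 1).tendsto_subseq' hsphere
    have he0 : e = 0 := by
      refine hCQ e (convexNormalCone_of_tendsto (hc.comp hφ.tendsto_atTop) hlim fun k =>
        smul_mem_convexNormalCone (hη _) (by positivity)) fun d => ?_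
      refine tendsto_nhds_unique (hlim.inner ((happly d).comp hφ.tendsto_atTop)) ?_
      have h1 : Tendsto (fun k => ‖η k‖⁻¹ * inner ℝ (η k) (fderiv ℝ G (q k) d)) atTop (𝓝 0) := by
        simpa using hatTop.inv_tendsto_atTop.mul (hderiv d)
      simpa [Function.comp_def, real_inner_smul_left] using h1.comp hφ.tendsto_atTop
    rw [he0] at he
    simp at he

omit [FiniteDimensional ℝ E] in
/-- The qualification condition is stable under perturbations of both points. -/
lemma eventually_forall_convexNormalCone_eq_zero {Y : Type*} [TopologicalSpace Y]
    [FirstCountableTopology Y] {A : Y → E →L[ℝ] H} {D : Set H} {a : Y} {b : H}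
    (hA : ContinuousAt A a)
    (h : ∀ η ∈ convexNormalCone D b, (∀ d, inner ℝ η (A a d) = 0) → η = 0) :
    ∀ᶠ z in 𝓝 (a, b), ∀ η ∈ convexNormalCone D z.2,
      (∀ d, inner ℝ η (A z.1 d) = 0) → η = 0 := by
  have : ProperSpace H := FiniteDimensional.proper ℝ H
  -- Violating normals at points converging to `(a, b)` can be scaled to norm one; a limit of them
  -- is a unit vector violating `h`.
  by_contra hcon
  obtain ⟨z, hz, hzP⟩ := exists_seq_forall_of_frequently (not_eventually.1 hcon)
  push Not at hzP
  choose η hη hzero hne using hzP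
  have hsphere : ∀ k, ‖η k‖⁻¹ • η k ∈ Metric.sphere (0 : H) 1 := fun k => by
    rw [mem_sphere_zero_iff_norm, norm_smul, norm_inv, norm_norm,
      inv_mul_cancel₀ (norm_ne_zero_iff.2 (hne k))]
  obtain ⟨e, he, φ, hφ, hlim⟩ := (isCompact_sphere (0 : H) 1).tendsto_subseq hsphere
  have hzφ := hz.comp hφ.tendsto_atTop
  have he0 : e = 0 := by
    refine h e (convexNormalCone_of_tendsto ((continuous_snd.tendsto _).comp hzφ) hlim fun k =>
      smul_mem_convexNormalCone (hη _) (by positivity)) fun d => ?_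
    have h1 : Tendsto (fun k => A (z (φ k)).1 d) atTop (𝓝 (A a d)) :=
      ((ContinuousLinearMap.apply ℝ H d).continuous.tendsto _).comp
        (hA.tendsto.comp ((continuous_fst.tendsto _).comp hzφ))
    refine tendsto_nhds_unique (hlim.inner h1) ?_
    simp [real_inner_smul_left, hzero]
  rw [he0] at he
  simp at he

end Preimage


/-! ### Epigraphs and the subdifferential chain rule -/

section Epigraph

variable {H : Type*} [NormedAddCommGroup H] [InnerProductSpace ℝ H]

omit [InnerProductSpace ℝ H] in
lemma isClosed_epigraph {g : H → EReal} (hg : LowerSemicontinuous g) :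
    IsClosed (epigraph g) := by
  have h : Continuous fun p : WithLp 2 (H × ℝ) => (p.fst, (p.snd : EReal)) :=
    (WithLp.continuous_fst 2 H ℝ).prodMk
      (continuous_coe_real_ereal.comp (WithLp.continuous_snd 2 H ℝ))
  exact hg.isClosed_epigraph.preimage h

lemma mem_limitingSubdifferential_iff {g : H → EReal} (hg : IsConvexFun g) {a : H} {r : ℝ}
    (ha : g a = r) {z : H} :
    z ∈ limitingSubdifferential g a ↔
      WithLp.toLp 2 (z, (-1 : ℝ)) ∈ convexNormalCone (epigraph g) (WithLp.toLp 2 (a, r)) := by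
  have hmem : WithLp.toLp 2 (a, r) ∈ epigraph g := by simp [epigraph, ha]
  simp [limitingSubdifferential, ha, limitingNormalCone_eq_convexNormalCone hg hmem]

lemma mem_singularSubdifferential_iff {g : H → EReal} (hg : IsConvexFun g) {a : H} {r : ℝ}
    (ha : g a = r) {z : H} :
    z ∈ singularSubdifferential g a ↔
      WithLp.toLp 2 (z, (0 : ℝ)) ∈ convexNormalCone (epigraph g) (WithLp.toLp 2 (a, r)) := by
  have hmem : WithLp.toLp 2 (a, r) ∈ epigraph g := by simp [epigraph, ha]
  simp [singularSubdifferential, ha, limitingNormalCone_eq_convexNormalCone hg hmem]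

/-- Horizontal normals to the epigraph are the normals to the effective domain. -/
lemma horizontal_mem_convexNormalCone_epigraph_iff {g : H → EReal} (hg : IsProper g) {a : H}
    {r : ℝ} {z : H} :
    WithLp.toLp 2 (z, (0 : ℝ)) ∈ convexNormalCone (epigraph g) (WithLp.toLp 2 (a, r)) ↔
      z ∈ convexNormalCone {w | g w ≠ ⊤} a := by
  constructor
  · intro h w hw
    have h1 := h (WithLp.toLp 2 (w, (g w).toReal))
      (by simp [epigraph, EReal.coe_toReal hw (hg.2 w)])
    simpa [WithLp.prod_inner_apply] using h1
  · intro h p hp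
    have h1 : g p.fst ≠ ⊤ := ne_top_of_le_ne_top (EReal.coe_ne_top _) hp
    simpa [WithLp.prod_inner_apply] using h _ h1

end Epigraph

/-! ### Sum and chain rule for the composite function -/

section ChainRule

variable {X Z : Type*} [NormedAddCommGroup X] [InnerProductSpace ℝ X]
  [NormedAddCommGroup Z] [InnerProductSpace ℝ Z]
  {f₀ : X → ℝ} {F : X → Z} {g : Z → EReal}

/-- The smooth mapping whose preimage of `epi g` is the epigraph of `x ↦ f₀ x + g (F x + u)`. -/
def epigraphMap (f₀ : X → ℝ) (F : X → Z) (u : Z) (p : WithLp 2 (X × ℝ)) : WithLp 2 (Z × ℝ) :=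
  WithLp.toLp 2 (F p.fst + u, p.snd - f₀ p.fst)

omit [NormedAddCommGroup X] [InnerProductSpace ℝ X] [InnerProductSpace ℝ Z] in
-- Finiteness of `f₀` permits moving it across the inequality in `EReal`, even where `g` is
-- infinite.
lemma epigraph_compositeFun (u : Z) :
    epigraph (fun x => compositeFun f₀ F g x u) = epigraphMap f₀ F u ⁻¹' epigraph g := by
  ext p
  simp only [epigraph, compositeFun, epigraphMap, Set.mem_ofPred_eq, Set.mem_preimage,
    WithLp.toLp_fst, WithLp.toLp_snd, EReal.coe_sub]
  rw [EReal.le_sub_iff_add_le (by simp) (by simp), add_comm]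

lemma contDiff_epigraphMap {k : WithTop ℕ∞} (hf₀ : ContDiff ℝ k f₀) (hF : ContDiff ℝ k F)
    (u : Z) : ContDiff ℝ k (epigraphMap f₀ F u) := by
  have h1 : ContDiff ℝ k fun p : WithLp 2 (X × ℝ) => p.fst := (WithLp.fstL 2 ℝ X ℝ).contDiff
  have h2 : ContDiff ℝ k fun p : WithLp 2 (X × ℝ) => p.snd := (WithLp.sndL 2 ℝ X ℝ).contDiff
  exact (WithLp.prodContinuousLinearEquiv 2 ℝ Z ℝ).symm.contDiff.comp
    (((hF.comp h1).add contDiff_const).prodMk (h2.sub (hf₀.comp h1)))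

lemma fderiv_epigraphMap {p : WithLp 2 (X × ℝ)} (hf₀ : DifferentiableAt ℝ f₀ p.fst)
    (hF : DifferentiableAt ℝ F p.fst) (u : Z) (d : WithLp 2 (X × ℝ)) :
    fderiv ℝ (epigraphMap f₀ F u) p d =
      WithLp.toLp 2 (fderiv ℝ F p.fst d.fst, d.snd - fderiv ℝ f₀ p.fst d.fst) := by
  have h1 : HasFDerivAt (fun p : WithLp 2 (X × ℝ) => p.fst) (WithLp.fstL 2 ℝ X ℝ) p :=
    (WithLp.fstL 2 ℝ X ℝ).hasFDerivAt
  have h2 : HasFDerivAt (fun p : WithLp 2 (X × ℝ) => p.snd) (WithLp.sndL 2 ℝ X ℝ) p :=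
    (WithLp.sndL 2 ℝ X ℝ).hasFDerivAt
  have h3 := ((WithLp.prodContinuousLinearEquiv 2 ℝ Z ℝ).symm.hasFDerivAt).comp p
    (((hF.hasFDerivAt.comp p h1).add_const u).prodMk (h2.sub (hf₀.hasFDerivAt.comp p h1)))
  have h4 : HasFDerivAt (epigraphMap f₀ F u) _ p := h3
  rw [h4.fderiv]
  rfl

omit [NormedAddCommGroup X] [InnerProductSpace ℝ X] [InnerProductSpace ℝ Z] in
lemma compositeFun_eq_coe {x : X} {u : Z} {r : ℝ} (h : g (F x + u) = r) :
    compositeFun f₀ F g x u = ((f₀ x + r : ℝ) : EReal) := by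
  rw [compositeFun, h, EReal.coe_add]

/-- Sum and chain rule, easy inclusion. -/
lemma mem_limitingSubdifferential_compositeFun [CompleteSpace X] [CompleteSpace Z]
    (hgc : IsConvexFun g)
    {x : X} {u : Z} (hf₀ : DifferentiableAt ℝ f₀ x) (hF : DifferentiableAt ℝ F x) {y : Z}
    (hy : y ∈ limitingSubdifferential g (F x + u)) :
    gradient f₀ x + ContinuousLinearMap.adjoint (fderiv ℝ F x) y ∈
      limitingSubdifferential (fun x' => compositeFun f₀ F g x' u) x := by
  obtain ⟨r, hr⟩ : ∃ r : ℝ, g (F x + u) = r := ⟨_, (EReal.coe_toReal hy.1 hy.2.1).symm⟩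
  have hφ := compositeFun_eq_coe (f₀ := f₀) hr
  have hn := (mem_limitingSubdifferential_iff hgc hr).1 hy
  refine ⟨hφ.trans_ne (EReal.coe_ne_top _), hφ.trans_ne (EReal.coe_ne_bot _), ?_⟩
  simp only [hφ, EReal.toReal_coe]
  -- Constant sequences suffice, because the vector is already a regular normal. Half of `ε` pays
  -- for linearizing `f₀`, the other half for linearizing `⟪y, F ·⟫`.
  refine ⟨fun _ => WithLp.toLp 2 (x, f₀ x + r), fun _ => _, tendsto_const_nhds,
    tendsto_const_nhds, fun _ => ⟨(hφ.le : _ ≤ ((f₀ x + r : ℝ) : EReal)), ?_⟩⟩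
  intro ε hε
  have ho := ((hf₀.hasFDerivAt.isLittleO.def (half_pos hε)).and
    ((((innerSL ℝ y).hasFDerivAt.comp x hF.hasFDerivAt).isLittleO).def (half_pos hε)))
  have hfst : Tendsto (fun p : WithLp 2 (X × ℝ) => p.fst)
      (𝓝[epigraph fun x' => compositeFun f₀ F g x' u] (WithLp.toLp 2 (x, f₀ x + r))) (𝓝 x) :=
    ((WithLp.continuous_fst 2 X ℝ).tendsto _).mono_left nhdsWithin_le_nhds
  filter_upwards [hfst.eventually ho, self_mem_nhdsWithin] with p ⟨h1, h2⟩ hp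
  rw [epigraph_compositeFun] at hp
  have h3 := hn _ hp
  have h4 : ‖p.fst - x‖ ≤ ‖p - WithLp.toLp 2 (x, f₀ x + r)‖ :=
    WithLp.norm_fst_le X (p - WithLp.toLp 2 (x, f₀ x + r))
  have h5 := (abs_le.1 h1).1
  have h6 := (abs_le.1 h2).1
  have hgrad : inner ℝ (gradient f₀ x) (p.fst - x) = fderiv ℝ f₀ x (p.fst - x) := by
    rw [gradient, InnerProductSpace.toDual_symm_apply]
  simp only [WithLp.prod_inner_apply, epigraphMap, WithLp.ofLp_fst, WithLp.ofLp_snd,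
    WithLp.sub_fst, WithLp.sub_snd, WithLp.toLp_fst, WithLp.toLp_snd] at h3 ⊢
  rw [inner_add_left, ContinuousLinearMap.adjoint_inner_left, hgrad]
  simp only [Function.comp_apply, innerSL_apply_apply, ContinuousLinearMap.comp_apply,
    map_sub, add_sub_add_right_eq_sub, inner_sub_right, real_inner_eq_re_inner] at h3 h5 h6 ⊢
  simp at h3 h5 h6 ⊢
  nlinarith [mul_le_mul_of_nonneg_left h4 hε.le]

variable [FiniteDimensional ℝ X] [FiniteDimensional ℝ Z]

/-- Sum and chain rule, under the qualification condition. -/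
lemma exists_of_mem_limitingSubdifferential_compositeFun [CompleteSpace X] [CompleteSpace Z]
    (hg : IsProper g) (hgl : LowerSemicontinuous g) (hgc : IsConvexFun g)
    (hf₀ : ContDiff ℝ 1 f₀) (hF : ContDiff ℝ 1 F) {x v : X} {u : Z}
    (hCQ : ∀ η ∈ convexNormalCone {w | g w ≠ ⊤} (F x + u),
      (∀ d, inner ℝ η (fderiv ℝ F x d) = 0) → η = 0)
    (hv : v ∈ limitingSubdifferential (fun x' => compositeFun f₀ F g x' u) x) :
    ∃ y ∈ limitingSubdifferential g (F x + u),
      v = gradient f₀ x + ContinuousLinearMap.adjoint (fderiv ℝ F x) y := by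
  obtain ⟨htop, hbot, hv⟩ := hv
  have hgtop : g (F x + u) ≠ ⊤ := by
    intro h
    exact htop (by simp [compositeFun, h])
  obtain ⟨r, hr⟩ : ∃ r : ℝ, g (F x + u) = r := ⟨_, (EReal.coe_toReal hgtop (hg.2 _)).symm⟩
  have hφ := compositeFun_eq_coe (f₀ := f₀) hr
  simp only [hφ, EReal.toReal_coe] at hv
  rw [epigraph_compositeFun] at hv
  have hd₀ := hf₀.differentiable one_ne_zero
  have hdF := hF.differentiable one_ne_zero
  have hG : epigraphMap f₀ F u (WithLp.toLp 2 (x, f₀ x + r)) = WithLp.toLp 2 (F x + u, r) := by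
    simp [epigraphMap]
  have hder := fun d => fderiv_epigraphMap (p := WithLp.toLp 2 (x, f₀ x + r)) (hd₀ x) (hdF x) u d
  simp only [WithLp.toLp_fst] at hder
  have hCQ' : ∀ η ∈ convexNormalCone (epigraph g)
      (epigraphMap f₀ F u (WithLp.toLp 2 (x, f₀ x + r))),
      (∀ d, inner ℝ η (fderiv ℝ (epigraphMap f₀ F u) (WithLp.toLp 2 (x, f₀ x + r)) d) = 0) →
        η = 0 := by
    intro η hη hzero
    rw [hG] at hη
    simp only [hder] at hzero
    -- Testing with the vertical direction shows that `η` is horizontal, hence a normal to the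
    -- effective domain, to which `hCQ` applies.
    have hsnd : η.snd = 0 := by
      have := hzero (WithLp.toLp 2 (0, 1))
      simpa [WithLp.prod_inner_apply] using this
    have hη' : η = WithLp.toLp 2 (η.fst, (0 : ℝ)) := by rw [← hsnd]; rfl
    have hfst : η.fst = 0 := by
      refine hCQ _ ((horizontal_mem_convexNormalCone_epigraph_iff hg).1 (hη' ▸ hη)) fun d => ?_
      have := hzero (WithLp.toLp 2 (d, 0))
      simpa [WithLp.prod_inner_apply, hsnd] using this
    rw [hη', hfst]
    rfl
  obtain ⟨η, hη, hvη⟩ := exists_normal_of_limitingNormalCone_preimage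
    (contDiff_epigraphMap hf₀ hF u) (isClosed_epigraph hgl) hgc hCQ' hv
  rw [hG] at hη
  simp only [hder] at hvη
  -- The vertical direction fixes the last component of the multiplier; the horizontal directions
  -- then give the subgradient formula.
  have hsnd : η.snd = -1 := by
    have := hvη (WithLp.toLp 2 (0, 1))
    simpa [WithLp.prod_inner_apply] using this.symm
  have hη' : η = WithLp.toLp 2 (η.fst, (-1 : ℝ)) := by rw [← hsnd]; rfl
  refine ⟨η.fst, (mem_limitingSubdifferential_iff hgc hr).2 (hη' ▸ hη), ?_⟩
  refine ext_inner_right ℝ fun d => ?_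
  have := hvη (WithLp.toLp 2 (d, 0))
  rw [inner_add_left, ContinuousLinearMap.adjoint_inner_left, gradient,
    InnerProductSpace.toDual_symm_apply]
  simp [WithLp.prod_inner_apply, hsnd] at this
  linarith

end ChainRule

/-! ### Local correspondence of the two graphs -/

/-- Under the qualification condition, `mapM₂` extends `mapM` by the graph coordinate at all
points near the reference point. -/
lemma eventually_extendsAt_mapM {X Z : Type*} [NormedAddCommGroup X] [InnerProductSpace ℝ X]
    [CompleteSpace X] [FiniteDimensional ℝ X] [NormedAddCommGroup Z] [InnerProductSpace ℝ Z]
    [CompleteSpace Z] [FiniteDimensional ℝ Z] {f₀ : X → ℝ} {F : X → Z} {g : Z → EReal}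
    (hf₀ : ContDiff ℝ 1 f₀) (hF : ContDiff ℝ 1 F)
    (hg : IsProper g) (hgl : LowerSemicontinuous g) (hgc : IsConvexFun g)
    {a : X} (ha : g (F a) ≠ ⊤) (hCQ : QualificationCondition F g a) (v : X) :
    ∀ᶠ z in 𝓝 (((v, 0), a) : (X × Z) × X),
      ExtendsAt (mapM (compositeFun f₀ F g)) (mapM₂ f₀ F g) F z := by
  have hCQ' : ∀ η ∈ convexNormalCone {w | g w ≠ ⊤} (F a),
      (∀ d, inner ℝ η (fderiv ℝ F a d) = 0) → η = 0 := by
    intro η hη hzero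
    refine hCQ η (ext_inner_right ℝ fun d => ?_) ?_
    · rw [ContinuousLinearMap.adjoint_inner_left, hzero, inner_zero_left]
    · exact (mem_singularSubdifferential_iff hgc (EReal.coe_toReal ha (hg.2 _)).symm).2
        ((horizontal_mem_convexNormalCone_epigraph_iff hg).2 hη)
  have hev := eventually_forall_convexNormalCone_eq_zero
    (hF.continuous_fderiv one_ne_zero).continuousAt hCQ'
  have hFc := hF.continuous
  have hcont : Tendsto (fun z : (X × Z) × X => (z.2, F z.2 + z.1.2)) (𝓝 ((v, 0), a))
      (𝓝 (a, F a)) := by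
    have : Continuous (fun z : (X × Z) × X => (z.2, F z.2 + z.1.2)) := by fun_prop
    simpa using this.tendsto (((v, 0), a) : (X × Z) × X)
  filter_upwards [hcont.eventually hev] with ⟨⟨v', u⟩, x⟩ hz
  constructor
  · intro h
    exact ⟨exists_of_mem_limitingSubdifferential_compositeFun hg hgl hgc hf₀ hF hz h, by simp⟩
  · rintro ⟨⟨y, hy, hv⟩, -⟩
    change v' = _ at hv
    change v' ∈ limitingSubdifferential (fun x' => compositeFun f₀ F g x' u) x
    rw [hv]
    exact mem_limitingSubdifferential_compositeFun hgc (hf₀.differentiable one_ne_zero x)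
      (hF.differentiable one_ne_zero x) hy

end CompositeStability

theorem mainTheorem9 (n m : ℕ)
    (f₀ : EuclideanSpace ℝ (Fin n) → ℝ)
    (F : EuclideanSpace ℝ (Fin n) → EuclideanSpace ℝ (Fin m))
    (g : EuclideanSpace ℝ (Fin m) → EReal)
    (hf₀ : ContDiff ℝ 2 f₀) (hF : ContDiff ℝ 2 F)
    (hg_proper : IsProper g) (hg_lsc : LowerSemicontinuous g) (hg_convex : IsConvexFun g)
    (xbar : EuclideanSpace ℝ (Fin n))
    (hxbar : xbar ∈ mapM (compositeFun f₀ F g) (0, 0))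
    (hCQ : QualificationCondition F g xbar) :
    ∃ N ∈ 𝓝 (((0, 0), xbar) :
        (EuclideanSpace ℝ (Fin n) × EuclideanSpace ℝ (Fin m)) × EuclideanSpace ℝ (Fin n)),
      ∀ (v : EuclideanSpace ℝ (Fin n)) (u : EuclideanSpace ℝ (Fin m))
        (x : EuclideanSpace ℝ (Fin n)),
        ((v, u), x) ∈ N ∩ gph (mapM (compositeFun f₀ F g)) →
        ((v, u), (x, F x + u)) ∈ gph (mapM₂ f₀ F g) ∧
        (IsolatedlyCalmAt (mapM (compositeFun f₀ F g)) (v, u) x ↔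
          IsolatedlyCalmAt (mapM₂ f₀ F g) (v, u) (x, F x + u)) ∧
        (IsolatedlyCalmAround (mapM (compositeFun f₀ F g)) (v, u) x ↔
          IsolatedlyCalmAround (mapM₂ f₀ F g) (v, u) (x, F x + u)) ∧
        (AubinPropertyAt (mapM (compositeFun f₀ F g)) (v, u) x ↔
          AubinPropertyAt (mapM₂ f₀ F g) (v, u) (x, F x + u)) ∧
        (HasLipschitzLocalization (mapM (compositeFun f₀ F g)) (v, u) x ↔
          HasLipschitzLocalization (mapM₂ f₀ F g) (v, u) (x, F x + u)) := by
  have hF1 : ContDiff ℝ 1 F := hF.of_le one_le_two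
  have hga : g (F xbar) ≠ ⊤ := by
    intro h
    exact hxbar.1 (by simp [compositeFun, h])
  have hT : ∀ p, ∀ q ∈ mapM₂ f₀ F g p, q.2 = F q.1 + p.2 := by
    rintro p q ⟨-, hq⟩
    rw [hq, add_sub_cancel]
  have hev := eventually_extendsAt_mapM (hf₀.of_le one_le_two) hF1 hg_proper hg_lsc hg_convex
    hga hCQ 0
  -- `N` consists of points having a whole neighborhood where the correspondence holds, as the
  -- transfer lemmas require at each of them.
  refine ⟨_, hev.eventually_nhds, ?_⟩
  rintro v u x ⟨hloc, hx⟩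
  obtain ⟨K, hK⟩ := hF1.locallyLipschitz x
  exact ⟨hloc.self_of_nhds.1 hx,
    isolatedlyCalmAt_iff_extension hT hloc hK hF.continuous,
    isolatedlyCalmAround_iff_extension hT hloc hK hF.continuous,
    ⟨aubinPropertyAt_extension hT hloc hK hF.continuous,
      aubinPropertyAt_of_extension hT hloc hF.continuous⟩,
    ⟨hasLipschitzLocalization_extension hT hloc hF1.locallyLipschitz,
      hasLipschitzLocalization_of_extension hT hloc hF.continuous⟩⟩
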